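/- Let $(F,\partial)$ be a differentially closed field of characteristic zero with commuting derivations $\partial=(\partial^1,\dots,\partial^m)^t$ that are linearly independent over $F$, and let $C$ be its field of constants. For $\delta=(\delta^1,\dots,\delta^m)^t$ let $GL^{\delta}(m,F)=\{g\in GL(m,F):\delta^i g^j_k=\delta^j g^i_k \text{ for all } i,j,k\}$ (upper index = row), and let $\mathbf B=\{g^{-1}\partial : g\in GL^{\partial}(m,F)\}$. For a differential polynomial or differential rational function (a quotient of two differential polynomials) $f$ over $C$, write $f^{\delta}$ for its evaluation with $\delta\in\mathbf B$ as the derivations; it is defined where its denominator does not vanish. For each $\delta\in\mathbf B$ let $W_\delta\subseteq F^l$ be a closed irreducible set in the $\delta$-differential Zariski topology; write $W_e=W_\partial$. Let $\tau=(\tau_1,\dots,\tau_l)$ be differential rational functions over $C$ in the components of $(h,g,\mathbf v)$, defined for all $\delta\in\mathbf B$, $(h,g)\in GL(n,F)\times GL^{\delta}(m,F)$, $\mathbf v\in W_\delta$, such that $\tau^{\delta}\langle h,g;\mathbf v\rangle\in W_{g^{-1}\delta}$, $\tau^\delta\langle I_n,I_m;\mathbf v\rangle=\mathbf v$ and $$\tau^{g^{-1}\delta}\langle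 h_1,g_1;\tau^{\delta}\langle h,g;\mathbf v\rangle\rangle=\tau^{\delta}\langle hh_1,gg_1;\mathbf v\rangle\qquad (h_1\in GL(n,F),\ g_1\in GL^{g^{-1}\delta}(m,F)).$$ Let $W_{0\delta}\subseteq W_\delta$ $(\delta\in\mathbf B)$ be dense subsets with $\tau^\delta\langle h,g;\mathbf v\rangle\in W_{0\,g^{-1}\delta}$ for $\mathbf v\in W_{0\delta}$, and let $P=(P_0,P_1)$ be a pair of matrices of differential rational functions over $C$ in $\mathbf x=(x_1,\dots,x_l)$, defined at every $\mathbf v\in W_{0\delta}$, with $P_0^\delta\langle\mathbf v\rangle\in GL(n,F)$, $P_1^\delta\langle\mathbf v\rangle\in GL^{\delta}(m,F)$ and $$P_0^{g^{-1}\delta}\langle\tau^\delta\langle h,g;\mathbf v\rangle\rangle=h^{-1}P_0^\delta\langle\mathbf v\rangle,\qquad P_1^{g^{-1}\delta}\langle\tau^\delta\langle h,g;\mathbf v\rangle\rangle=g^{-1}P_1^\delta\langle\mathbf v\rangle$$ for all $\delta\in\mathbf B$, $\mathbf v\in W_{0\delta}$, $(h,g)\in GL(n,F)\times GL^{\delta}(m,F)$.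 Let $C\langle W_e;\partial\rangle$ be the field of $\partial$-differential rational functions on $W_e$ with coefficients in $C$, that is, the fraction field of the ring of $\partial$-differential polynomials over $C$ modulo those vanishing on $W_e$, with its induced derivations $\partial$. Let $C\langle W_e;\partial\rangle^G$ be the set of its elements $f^\partial\langle\mathbf x\rangle$, where $f$ is a differential rational function over $C$ whose denominator does not vanish identically on any $W_\delta$, $\delta\in\mathbf B$, and which satisfies $f^{g^{-1}\delta}\langle\tau^\delta\langle h,g;\mathbf v\rangle\rangle=f^\delta\langle\mathbf v\rangle$ for all $\delta\in\mathbf B$, $(h,g)\in GL(n,F)\times GL^\delta(m,F)$, $\mathbf v\in W_\delta$ for which both sides are defined. Then $P_0^\partial\langle\mathbf x\rangle$ and $P_1^\partial\langle\mathbf x\rangle$ are invertible matrices over $C\langle W_e;\partial\rangle$, the derivations $\delta=P_1^{\partial}\langle\mathbf x\rangle^{-1}\partial$ of $C\langle W_e;\partial\rangle$ commute, and as a $\delta$-differential field $C\langle W_e;\partial\rangle$ is generated over $C\langle W_e;\partial\rangle^G$ by the components of $P^{\partial}\langle\mathbf x\rangle$: $$C\langle W_e;\partial\rangle=C\langle W_e;\partial\rangle^G\langle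 P^{\partial}\langle\mathbf x\rangle;\delta\rangle,$$ i.e. the smallest subfield of $C\langle W_e;\partial\rangle$ that contains $C\langle W_e;\partial\rangle^G$ and all entries of $P_0^\partial\langle\mathbf x\rangle$ and $P_1^\partial\langle\mathbf x\rangle$ and is stable under $\delta^1,\dots,\delta^m$ is $C\langle W_e;\partial\rangle$ itself. -/

import Mathlib

noncomputable section

namespace DiffInv

open scoped Topology

universe u

/-! ### Partial differential fields -/

section Basic

variable {F : Type*} [Field F] {m : ℕ}

/-- The operators `d 0, …, d (m-1)` commute pairwise. -/
def Commuting (d : Fin m → Derivation ℤ F F) : Prop :=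
  ∀ (i j : Fin m) (a : F), d i (d j a) = d j (d i a)

/-- The constant field `{a | d i a = 0 for all i}`. -/
def constants (d : Fin m → Derivation ℤ F F) : Subfield F where
  carrier := {a | ∀ i, d i a = 0}
  mul_mem' := by
    intro a b ha hb i
    simp [Derivation.leibniz, ha i, hb i]
  one_mem' := by intro i; simp
  add_mem' := by
    intro a b ha hb i
    simp [ha i, hb i]
  zero_mem' := by intro i; simp
  neg_mem' := by
    intro a ha i
    simp [ha i]
  inv_mem' := by
    intro a ha i
    simp [Derivation.leibniz_inv, ha i]

/-- The composite `(d 0)^(α 0) ∘ ⋯ ∘ (d (m-1))^(α (m-1))`; used for commuting operators only. -/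
def iterD (d : Fin m → Derivation ℤ F F) (α : Fin m → ℕ) : Module.End ℤ F :=
  ((List.finRange m).map fun i => ((d i : F →ₗ[ℤ] F) : Module.End ℤ F) ^ α i).prod

/-- The system of operators `g⁻¹ d`. -/
def twist (g : Matrix (Fin m) (Fin m) F) (d : Fin m → Derivation ℤ F F) :
    Fin m → Derivation ℤ F F :=
  fun i => ∑ j, g⁻¹ i j • d j

/-- Membership in `GL^d(m, F)`: the matrix `g`, with rows indexed by the upper index, is invertible
and `d i (g j k) = d j (g i k)`. -/
def MemGL (d : Fin m → Derivation ℤ F F) (g : Matrix (Fin m) (Fin m) F) : Prop :=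
  IsUnit g.det ∧ ∀ i j k, d i (g j k) = d j (g i k)

/-- The base of the groupoid: all `g⁻¹ d` with `g ∈ GL^d(m, F)`. -/
def base (d : Fin m → Derivation ℤ F F) : Set (Fin m → Derivation ℤ F F) :=
  {δ | ∃ g, MemGL d g ∧ δ = twist g d}

theorem mem_base_self (d : Fin m → Derivation ℤ F F) : d ∈ base d := by
  refine ⟨1, ⟨by simp, ?_⟩, ?_⟩
  · intro i j k
    by_cases h1 : j = k <;> by_cases h2 : i = k <;> simp [Matrix.one_apply, h1, h2]
  · funext i
    simp [twist, Matrix.one_apply]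

end Basic

/-! ### Differential polynomials -/

/-- Differential polynomials over `R`, with constant coefficients or with coefficients in a
differential field, in the indeterminates `x_i` (`i : ι`) and `m` commuting derivations:
the variable `(i, α)` stands for the derivative of `x_i` of multi-index `α`. -/
abbrev DiffPoly (R : Type*) [CommRing R] (m : ℕ) (ι : Type*) :=
  MvPolynomial (ι × (Fin m → ℕ)) R

/-- The value `p^d{v}` of a differential polynomial at `v`, with respect to the operators `d`. -/
def diffEval {R K ι : Type*} [CommRing R] [Field K] [Algebra R K] {m : ℕ}
    (d : Fin m → Derivation ℤ K K) (v : ι → K) : DiffPoly R m ι →ₐ[R] K :=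
  MvPolynomial.aeval fun x => iterD d x.2 (v x.1)

/-- The `i`-th derivation of the ring of differential polynomials with constant coefficients. -/
def polyDer (R : Type*) [CommRing R] (m : ℕ) (ι : Type*) (i : Fin m) :
    Derivation R (DiffPoly R m ι) (DiffPoly R m ι) :=
  MvPolynomial.mkDerivation R fun x => MvPolynomial.X (x.1, x.2 + Pi.single i 1)

/-- `(F, d)` is differentially closed: every finite system of differential polynomial equations
and an inequation over `F` that has a solution in some differential field extension (with
commuting derivations) has a solution in `F`. -/
def IsDifferentiallyClosed {F : Type u} [Field F] {m : ℕ} (d : Fin m → Derivation ℤ F F) : Prop :=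
  ∀ (E : Type u) [Field E] [Algebra F E] (e : Fin m → Derivation ℤ E E),
    Commuting e → (∀ i a, e i (algebraMap F E a) = algebraMap F E (d i a)) →
    ∀ (k : ℕ) (Sys : Finset (DiffPoly F m (Fin k))) (q : DiffPoly F m (Fin k)),
      (∃ y : Fin k → E, (∀ p ∈ Sys, diffEval e y p = 0) ∧ diffEval e y q ≠ 0) →
      ∃ y : Fin k → F, (∀ p ∈ Sys, diffEval d y p = 0) ∧ diffEval d y q ≠ 0

section Topology

variable {F : Type*} [Field F] {m : ℕ} {ι : Type*}

/-- The common zeros in `F^ι` of a set of `d`-differential polynomials over `F`. -/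
def zeroLocus (d : Fin m → Derivation ℤ F F) (S : Set (DiffPoly F m ι)) : Set (ι → F) :=
  {v | ∀ p ∈ S, diffEval d v p = 0}

/-- The `d`-differential Zariski topology on `F^ι`: the closed sets are the zero loci. -/
@[reducible]
def kolchinTopology (d : Fin m → Derivation ℤ F F) : TopologicalSpace (ι → F) :=
  TopologicalSpace.ofClosed (Set.range (zeroLocus d))
    ⟨{1}, by ext v; simp [zeroLocus]⟩
    (by
      intro A hA
      refine ⟨{p | ∃ S, zeroLocus d S ∈ A ∧ p ∈ S}, ?_⟩
      ext v
      constructor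
      · intro hv Z hZ
        obtain ⟨S, rfl⟩ := hA hZ
        exact fun p hp => hv p ⟨S, hZ, hp⟩
      · rintro hv p ⟨S, hS, hp⟩
        exact hv _ hS p hp)
    (by
      rintro _ ⟨S, rfl⟩ _ ⟨T, rfl⟩
      refine ⟨{r | ∃ p ∈ S, ∃ q ∈ T, r = p * q}, ?_⟩
      ext v
      constructor
      · intro hv
        by_contra hcon
        rw [Set.mem_union, not_or] at hcon
        obtain ⟨h1, h2⟩ := hcon
        simp only [zeroLocus, Set.mem_ofPred_eq, not_forall] at h1 h2
        obtain ⟨p, hp, hp0⟩ := h1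
        obtain ⟨q, hq, hq0⟩ := h2
        have := hv (p * q) ⟨p, hp, q, hq, rfl⟩
        rw [map_mul] at this
        exact (mul_ne_zero hp0 hq0) this
      · rintro hv _ ⟨p, hp, q, hq, rfl⟩
        rw [map_mul]
        rcases hv with hv | hv
        · rw [hv p hp, zero_mul]
        · rw [hv q hq, mul_zero])

theorem isClosed_iff (d : Fin m → Derivation ℤ F F) (Z : Set (ι → F)) :
    IsClosed[kolchinTopology d] Z ↔ ∃ S, zeroLocus d S = Z := by
  rw [← @isOpen_compl_iff _ _ (kolchinTopology d)]
  change Zᶜᶜ ∈ Set.range (zeroLocus d) ↔ _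
  rw [compl_compl]
  rfl

/-- An irreducible closed subset of `F^ι`. -/
structure IrreducibleClosed (d : Fin m → Derivation ℤ F F) (ι : Type*) where
  carrier : Set (ι → F)
  isClosed : IsClosed[kolchinTopology d] carrier
  isIrreducible : @IsIrreducible _ (kolchinTopology d) carrier

end Topology

/-- The ring homomorphism `p ↦ f p + ε f (D p)` into the dual numbers over `K`. -/
def dualHom {R A K : Type*} [CommRing R] [CommRing A] [Algebra R A] [Field K] (f : A →+* K)
    (D : Derivation R A A) : A →+* TrivSqZeroExt K K where
  toFun p := TrivSqZeroExt.inl (f p) + TrivSqZeroExt.inr (f (D p))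
  map_one' := by
    ext <;> simp
  map_mul' p q := by
    ext
    · simp
    · simp [mul_comm]
  map_zero' := by
    ext <;> simp
  map_add' p q := by
    ext <;> simp

theorem dualHom_fst {R A K : Type*} [CommRing R] [CommRing A] [Algebra R A] [Field K]
    (f : A →+* K) (D : Derivation R A A) (p : A) : (dualHom f D p).fst = f p := by
  simp [dualHom]

theorem dualHom_snd {R A K : Type*} [CommRing R] [CommRing A] [Algebra R A] [Field K]
    (f : A →+* K) (D : Derivation R A A) (p : A) : (dualHom f D p).snd = f (D p) := by
  simp [dualHom]

theorem exists_derivation_aux {Q K : Type*} [CommRing Q] [Field K] [Algebra Q K]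
    [IsFractionRing Q K] (f : Q →+* TrivSqZeroExt K K)
    (hfst : ∀ a : Q, (f a).fst = algebraMap Q K a) :
    ∃ D : Derivation ℤ K K, ∀ a : Q, D (algebraMap Q K a) = (f a).snd := by
  have hu : ∀ y : nonZeroDivisors Q, IsUnit (f y) := by
    intro y
    rw [TrivSqZeroExt.isUnit_iff_isUnit_fst, hfst]
    exact IsLocalization.map_units K y
  let g : K →+* TrivSqZeroExt K K := IsLocalization.lift hu
  have hg : ∀ a : Q, g (algebraMap Q K a) = f a := fun a => IsLocalization.lift_eq hu a
  have hgf : ∀ x, (g x).fst = x := by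
    intro x
    have h : (TrivSqZeroExt.fstHom ℤ K K).toRingHom.comp g = RingHom.id _ := by
      apply IsLocalization.ringHom_ext (nonZeroDivisors Q)
      ext1 a
      simp only [RingHom.comp_apply, hg]
      exact hfst a
    exact RingHom.congr_fun h x
  let D0 : K →+ K :=
    { toFun := fun x => (g x).snd
      map_zero' := by simp
      map_add' := by intro x y; simp }
  refine ⟨Derivation.mk' D0.toIntLinearMap ?_, ?_⟩
  · intro x y
    change (g (x * y)).snd = x • (g y).snd + y • (g x).snd
    rw [map_mul, TrivSqZeroExt.snd_mul, hgf, hgf]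
    simp [mul_comm]
  · intro a
    change (g (algebraMap Q K a)).snd = _
    rw [hg]

/-! ### The field of differential rational functions on an irreducible closed set -/

section FunctionField

variable {F : Type*} [Field F] {m : ℕ} {ι : Type*} {d : Fin m → Derivation ℤ F F}

/-- The differential polynomials with constant coefficients that vanish on `V`. -/
def vanishingIdeal (V : IrreducibleClosed d ι) : Ideal (DiffPoly (constants d) m ι) where
  carrier := {p | ∀ v ∈ V.carrier, diffEval d v p = 0}
  add_mem' := by
    intro p q hp hq v hv
    rw [map_add, hp v hv, hq v hv, add_zero]
  zero_mem' := by intro v _; simp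
  smul_mem' := by
    intro c p hp v hv
    rw [smul_eq_mul, map_mul, hp v hv, mul_zero]

theorem mem_vanishingIdeal {V : IrreducibleClosed d ι} {p : DiffPoly (constants d) m ι} :
    p ∈ vanishingIdeal V ↔ ∀ v ∈ V.carrier, diffEval d v p = 0 := Iff.rfl

theorem diffEval_map (v : ι → F) (p : DiffPoly (constants d) m ι) :
    diffEval d v (MvPolynomial.map (algebraMap (constants d) F) p) = diffEval d v p := by
  simp [diffEval, MvPolynomial.aeval_map_algebraMap]

theorem isOpen_ne_zero (p : DiffPoly (constants d) m ι) :
    IsOpen[kolchinTopology d] {v : ι → F | diffEval d v p ≠ 0} := by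
  have h : IsClosed[kolchinTopology d] {v : ι → F | diffEval d v p = 0} := by
    rw [isClosed_iff]
    refine ⟨{MvPolynomial.map (algebraMap (constants d) F) p}, ?_⟩
    ext v
    simp [zeroLocus, diffEval_map]
  exact (@isOpen_compl_iff _ _ (kolchinTopology d)).2 h

instance vanishingIdeal_isPrime (V : IrreducibleClosed d ι) : (vanishingIdeal V).IsPrime := by
  refine ⟨?_, ?_⟩
  · intro h
    obtain ⟨v, hv⟩ := @IsIrreducible.nonempty _ (kolchinTopology d) _ V.isIrreducible
    have h1 : (1 : DiffPoly (constants d) m ι) ∈ vanishingIdeal V := by rw [h]; trivial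
    simpa using h1 v hv
  · intro p q hpq
    by_contra hcon
    rw [not_or] at hcon
    obtain ⟨hp, hq⟩ := hcon
    simp only [mem_vanishingIdeal, not_forall] at hp hq
    obtain ⟨v, hv, hpv⟩ := hp
    obtain ⟨w, hw, hqw⟩ := hq
    obtain ⟨z, hz, hz1, hz2⟩ :=
      (@IsIrreducible.isPreirreducible _ (kolchinTopology d) _ V.isIrreducible) _ _
        (isOpen_ne_zero p) (isOpen_ne_zero q) ⟨v, hv, hpv⟩ ⟨w, hw, hqw⟩
    have := hpq z hz
    rw [map_mul] at this
    exact (mul_ne_zero hz1 hz2) this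

/-- The field `C⟨V; d⟩` of `d`-differential rational functions on `V` with constant coefficients:
the fraction field of the ring of differential polynomial functions on `V`. -/
def FunctionField (V : IrreducibleClosed d ι) :=
  FractionRing (DiffPoly (constants d) m ι ⧸ vanishingIdeal V)

instance (V : IrreducibleClosed d ι) : Field (FunctionField V) :=
  inferInstanceAs (Field (FractionRing (DiffPoly (constants d) m ι ⧸ vanishingIdeal V)))

instance (V : IrreducibleClosed d ι) :
    Algebra (DiffPoly (constants d) m ι ⧸ vanishingIdeal V) (FunctionField V) :=
  inferInstanceAs (Algebra (DiffPoly (constants d) m ι ⧸ vanishingIdeal V)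
    (FractionRing (DiffPoly (constants d) m ι ⧸ vanishingIdeal V)))

instance (V : IrreducibleClosed d ι) :
    IsFractionRing (DiffPoly (constants d) m ι ⧸ vanishingIdeal V) (FunctionField V) :=
  inferInstanceAs (IsFractionRing (DiffPoly (constants d) m ι ⧸ vanishingIdeal V)
    (FractionRing (DiffPoly (constants d) m ι ⧸ vanishingIdeal V)))

/-- The class in `C⟨V; d⟩` of a differential polynomial. -/
def toField (V : IrreducibleClosed d ι) : DiffPoly (constants d) m ι →+* FunctionField V :=
  (algebraMap _ (FunctionField V)).comp (Ideal.Quotient.mk (vanishingIdeal V))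

theorem iterD_list {D : Fin m → Module.End ℤ F} (hD : ∀ i j, Commute (D i) (D j))
    (α : Fin m → ℕ) (i : Fin m) (L : List (Fin m)) (hL : L.Nodup) (hi : i ∈ L) :
    (L.map fun j => D j ^ (α + Pi.single i 1 : Fin m → ℕ) j).prod =
      D i * (L.map fun j => D j ^ α j).prod := by
  induction L with
  | nil => simp at hi
  | cons a L ih =>
    rw [List.nodup_cons] at hL
    by_cases h : a = i
    · subst h
      have h2 : (L.map fun j => D j ^ (α + Pi.single a 1 : Fin m → ℕ) j) =
          L.map fun j => D j ^ α j := by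
        apply List.map_congr_left
        intro j hj
        have : j ≠ a := fun e => hL.1 (e ▸ hj)
        simp [this]
      simp only [List.map_cons, List.prod_cons, h2]
      rw [Pi.add_apply, Pi.single_eq_same, pow_succ', mul_assoc]
    · have hi' : i ∈ L := by
        rcases List.mem_cons.1 hi with h' | h'
        · exact absurd h'.symm h
        · exact h'
      simp only [List.map_cons, List.prod_cons, ih hL.2 hi']
      rw [Pi.add_apply, Pi.single_eq_of_ne h, add_zero, ← mul_assoc,
        ((hD i a).pow_right (α a)).symm.eq, mul_assoc]

theorem iterD_add_single (hd : Commuting d) (α : Fin m → ℕ) (i : Fin m) (a : F) :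
    iterD d (α + Pi.single i 1) a = d i (iterD d α a) := by
  have hD : ∀ i j, Commute ((d i : F →ₗ[ℤ] F) : Module.End ℤ F) ((d j : F →ₗ[ℤ] F)) := by
    intro i j
    ext a
    exact hd i j a
  have := iterD_list hD α i (List.finRange m) (List.nodup_finRange m) (List.mem_finRange i)
  unfold iterD
  rw [this]
  rfl

/-- Evaluation commutes with the derivations. -/
theorem diffEval_polyDer (hd : Commuting d) (i : Fin m) (v : ι → F)
    (p : DiffPoly (constants d) m ι) :
    diffEval d v (polyDer _ m ι i p) = d i (diffEval d v p) := by
  induction p using MvPolynomial.induction_on with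
  | C a =>
    have h1 : polyDer (constants d) m ι i (MvPolynomial.C a) = 0 := by
      exact Derivation.map_algebraMap _ a
    rw [h1, map_zero]
    have h2 : diffEval d v (MvPolynomial.C a) = (a : F) := by
      simp [diffEval]
      rfl
    rw [h2, a.2 i]
  | add p q hp hq => simp [hp, hq]
  | mul_X p x hp =>
    have h1 : polyDer (constants d) m ι i (MvPolynomial.X x) =
        MvPolynomial.X (x.1, x.2 + Pi.single i 1) := by
      rw [polyDer, MvPolynomial.mkDerivation_X]
    have h2 : ∀ x : ι × (Fin m → ℕ), diffEval d v
        (MvPolynomial.X x : DiffPoly (constants d) m ι) = iterD d x.2 (v x.1) := by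
      intro x
      simp [diffEval]
    rw [Derivation.leibniz, h1]
    simp only [map_add, smul_eq_mul, map_mul, h2, hp, Derivation.leibniz]
    rw [iterD_add_single hd]

theorem polyDer_mem (hd : Commuting d) (V : IrreducibleClosed d ι) (i : Fin m)
    {p : DiffPoly (constants d) m ι} (hp : p ∈ vanishingIdeal V) :
    polyDer _ m ι i p ∈ vanishingIdeal V := by
  intro v hv
  rw [diffEval_polyDer hd, hp v hv, map_zero]

theorem toField_eq_zero {V : IrreducibleClosed d ι} {p : DiffPoly (constants d) m ι} :
    toField V p = 0 ↔ p ∈ vanishingIdeal V := by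
  have h := IsLocalization.injective (FunctionField V)
    (le_refl (nonZeroDivisors (DiffPoly (constants d) m ι ⧸ vanishingIdeal V)))
  rw [toField, RingHom.comp_apply, map_eq_zero_iff _ h, Ideal.Quotient.eq_zero_iff_mem]

theorem exists_derivation (hd : Commuting d) (V : IrreducibleClosed d ι) (i : Fin m) :
    ∃ D : Derivation ℤ (FunctionField V) (FunctionField V),
      ∀ p, D (toField V p) = toField V (polyDer _ m ι i p) := by
  obtain ⟨D, hD⟩ := exists_derivation_aux (K := FunctionField V)
    (Ideal.Quotient.lift (vanishingIdeal V) (dualHom (toField V) (polyDer (constants d) m ι i)) (by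
      intro p hp
      have h1 := toField_eq_zero.2 hp
      have h2 := toField_eq_zero.2 (polyDer_mem hd V i hp)
      exact TrivSqZeroExt.ext ((dualHom_fst _ _ _).trans h1) ((dualHom_snd _ _ _).trans h2)))
    (by
      intro a
      obtain ⟨p, rfl⟩ := Ideal.Quotient.mk_surjective a
      rw [Ideal.Quotient.lift_mk, dualHom_fst]
      rfl)
  refine ⟨D, fun p => ?_⟩
  refine (hD (Ideal.Quotient.mk _ p)).trans ?_
  rw [Ideal.Quotient.lift_mk, dualHom_snd]

/-- The derivations of `C⟨V; d⟩`: the extensions of the derivations of the differential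
polynomials (a derivation of an integral domain extends to its fraction field uniquely). -/
def fieldDer (hd : Commuting d) (V : IrreducibleClosed d ι) (i : Fin m) :
    Derivation ℤ (FunctionField V) (FunctionField V) :=
  (exists_derivation hd V i).choose

theorem fieldDer_toField (hd : Commuting d) (V : IrreducibleClosed d ι) (i : Fin m)
    (p : DiffPoly (constants d) m ι) :
    fieldDer hd V i (toField V p) = toField V (polyDer _ m ι i p) :=
  (exists_derivation hd V i).choose_spec p

end FunctionField

/-! ### Differential rational functions -/

/-- A differential rational expression: a quotient of two differential polynomials. Its
coefficients do not depend on the operators with respect to which it is evaluated. -/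
structure DiffRat (R : Type*) [CommRing R] (m : ℕ) (ι : Type*) where
  num : DiffPoly R m ι
  den : DiffPoly R m ι

namespace DiffRat

variable {R K ι : Type*} [CommRing R] [Field K] [Algebra R K] {m : ℕ}

/-- The denominator of `f^δ` does not vanish at `v`. -/
def DefinedAt (f : DiffRat R m ι) (δ : Fin m → Derivation ℤ K K) (v : ι → K) : Prop :=
  diffEval δ v f.den ≠ 0

/-- The value `f^δ⟨v⟩`, meaningful where `f^δ` is defined at `v`. -/
def eval (f : DiffRat R m ι) (δ : Fin m → Derivation ℤ K K) (v : ι → K) : K :=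
  diffEval δ v f.num / diffEval δ v f.den

/-- The element `f^d⟨x⟩` of the field `C⟨V; d⟩`, meaningful if the denominator of `f` does not
vanish identically on `V`. -/
def toField {F : Type*} [Field F] {d : Fin m → Derivation ℤ F F} (V : IrreducibleClosed d ι)
    (f : DiffRat (constants d) m ι) : FunctionField V :=
  DiffInv.toField V f.num / DiffInv.toField V f.den

end DiffRat

/-! ### Algebraic representations of the groupoid and equivariant maps -/

section Action

variable {F : Type*} [Field F] {m : ℕ}

/-- Index type for the components of a triple `(h, g, v)`: the entries of an `n × n` matrix `h`,
the entries of an `m × m` matrix `g`, and the `l` components of `v`. -/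
abbrev TripleIndex (n m l : ℕ) := (Fin n × Fin n) ⊕ (Fin m × Fin m) ⊕ Fin l

/-- The list of components of `(h, g, v)`. -/
def triple {n l : ℕ} (h : Matrix (Fin n) (Fin n) F) (g : Matrix (Fin m) (Fin m) F)
    (v : Fin l → F) : TripleIndex n m l → F :=
  Sum.elim (fun a => h a.1 a.2) (Sum.elim (fun a => g a.1 a.2) v)

/-- The value `τ^δ⟨h, g; v⟩`. -/
def act {R : Type*} [CommRing R] [Algebra R F] {n l : ℕ}
    (τ : Fin l → DiffRat R m (TripleIndex n m l)) (δ : Fin m → Derivation ℤ F F)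
    (h : Matrix (Fin n) (Fin n) F) (g : Matrix (Fin m) (Fin m) F) (v : Fin l → F) : Fin l → F :=
  fun i => (τ i).eval δ (triple h g v)

/-- The value at `v`, with respect to `δ`, of a matrix of differential rational functions. -/
def evalMatrix {R : Type*} [CommRing R] [Algebra R F] {k l : ℕ}
    (P : Matrix (Fin k) (Fin k) (DiffRat R m (Fin l))) (δ : Fin m → Derivation ℤ F F)
    (v : Fin l → F) : Matrix (Fin k) (Fin k) F :=
  fun i j => (P i j).eval δ v

/-- An algebraic (anti)representation of the groupoid with base `base d` and fibres
`GL(n, F) × GL^δ(m, F)` on a bundle `W = ⋃ (δ, W δ)`, `W δ ⊆ F^l`, whose fibres are closed and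
irreducible. The components of `τ` are differential rational functions in `h, g, v` with constant
coefficients, defined on all of `GL(n, F) × GL^δ(m, F) × W δ`. -/
structure AlgebraicAction (d : Fin m → Derivation ℤ F F) (n l : ℕ) where
  W : (Fin m → Derivation ℤ F F) → Set (Fin l → F)
  isClosed_W : ∀ δ ∈ base d, IsClosed[kolchinTopology δ] (W δ)
  isIrreducible_W : ∀ δ ∈ base d, @IsIrreducible _ (kolchinTopology δ) (W δ)
  τ : Fin l → DiffRat (constants d) m (TripleIndex n m l)
  definedAt_τ : ∀ δ ∈ base d, ∀ (h : Matrix (Fin n) (Fin n) F) (g : Matrix (Fin m) (Fin m) F),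
    IsUnit h.det → MemGL δ g → ∀ v ∈ W δ, ∀ i, (τ i).DefinedAt δ (triple h g v)
  act_mem : ∀ δ ∈ base d, ∀ (h : Matrix (Fin n) (Fin n) F) (g : Matrix (Fin m) (Fin m) F),
    IsUnit h.det → MemGL δ g → ∀ v ∈ W δ, act τ δ h g v ∈ W (twist g δ)
  act_one : ∀ δ ∈ base d, ∀ v ∈ W δ, act τ δ 1 1 v = v
  act_act : ∀ δ ∈ base d, ∀ (h h₁ : Matrix (Fin n) (Fin n) F) (g g₁ : Matrix (Fin m) (Fin m) F),
    IsUnit h.det → IsUnit h₁.det → MemGL δ g → MemGL (twist g δ) g₁ → ∀ v ∈ W δ,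
      act τ (twist g δ) h₁ g₁ (act τ δ h g v) = act τ δ (h * h₁) (g * g₁) v

/-- A map `P = (P₀, P₁) : W₀ → G`, `P^δ⟨v⟩ ∈ GL(n, F) × GL^δ(m, F)`, defined on an invariant
fibrewise dense subset `W₀` of `W`, whose components are differential rational functions with
constant coefficients, and with `P^(g⁻¹δ)⟨τ^δ⟨h, g; v⟩⟩ = (h⁻¹, g⁻¹) P^δ⟨v⟩`. -/
structure EquivariantMap {d : Fin m → Derivation ℤ F F} {n l : ℕ} (T : AlgebraicAction d n l) where
  W₀ : (Fin m → Derivation ℤ F F) → Set (Fin l → F)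
  subset_W : ∀ δ ∈ base d, W₀ δ ⊆ T.W δ
  dense_W₀ : ∀ δ ∈ base d, T.W δ ⊆ @closure _ (kolchinTopology δ) (W₀ δ)
  act_mem : ∀ δ ∈ base d, ∀ (h : Matrix (Fin n) (Fin n) F) (g : Matrix (Fin m) (Fin m) F),
    IsUnit h.det → MemGL δ g → ∀ v ∈ W₀ δ, act T.τ δ h g v ∈ W₀ (twist g δ)
  P₀ : Matrix (Fin n) (Fin n) (DiffRat (constants d) m (Fin l))
  P₁ : Matrix (Fin m) (Fin m) (DiffRat (constants d) m (Fin l))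
  definedAt_P₀ : ∀ δ ∈ base d, ∀ v ∈ W₀ δ, ∀ i j, (P₀ i j).DefinedAt δ v
  definedAt_P₁ : ∀ δ ∈ base d, ∀ v ∈ W₀ δ, ∀ i j, (P₁ i j).DefinedAt δ v
  isUnit_P₀ : ∀ δ ∈ base d, ∀ v ∈ W₀ δ, IsUnit (evalMatrix P₀ δ v).det
  memGL_P₁ : ∀ δ ∈ base d, ∀ v ∈ W₀ δ, MemGL δ (evalMatrix P₁ δ v)
  equivariant_P₀ : ∀ δ ∈ base d, ∀ (h : Matrix (Fin n) (Fin n) F) (g : Matrix (Fin m) (Fin m) F),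
    IsUnit h.det → MemGL δ g → ∀ v ∈ W₀ δ,
      evalMatrix P₀ (twist g δ) (act T.τ δ h g v) = h⁻¹ * evalMatrix P₀ δ v
  equivariant_P₁ : ∀ δ ∈ base d, ∀ (h : Matrix (Fin n) (Fin n) F) (g : Matrix (Fin m) (Fin m) F),
    IsUnit h.det → MemGL δ g → ∀ v ∈ W₀ δ,
      evalMatrix P₁ (twist g δ) (act T.τ δ h g v) = g⁻¹ * evalMatrix P₁ δ v

variable {d : Fin m → Derivation ℤ F F} {n l : ℕ}

/-- The fibre `W_e` of `W` over `d`. -/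
def AlgebraicAction.We (T : AlgebraicAction d n l) : IrreducibleClosed d (Fin l) where
  carrier := T.W d
  isClosed := T.isClosed_W d (mem_base_self d)
  isIrreducible := T.isIrreducible_W d (mem_base_self d)

/-- `f = (f^δ)` is a differential rational function on `W` with constant coefficients: its
denominator does not vanish identically on any fibre of `W`. -/
def AlgebraicAction.IsRational (T : AlgebraicAction d n l)
    (f : DiffRat (constants d) m (Fin l)) : Prop :=
  ∀ δ ∈ base d, ∃ v ∈ T.W δ, f.DefinedAt δ v

/-- `f^(g⁻¹δ)⟨τ^δ⟨h, g; v⟩⟩ = f^δ⟨v⟩` wherever both sides are defined. -/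
def AlgebraicAction.IsInvariant (T : AlgebraicAction d n l)
    (f : DiffRat (constants d) m (Fin l)) : Prop :=
  ∀ δ ∈ base d, ∀ (h : Matrix (Fin n) (Fin n) F) (g : Matrix (Fin m) (Fin m) F),
    IsUnit h.det → MemGL δ g → ∀ v ∈ T.W δ,
      f.DefinedAt δ v → f.DefinedAt (twist g δ) (act T.τ δ h g v) →
        f.eval (twist g δ) (act T.τ δ h g v) = f.eval δ v

/-- The field `C⟨W_e; d⟩^G` of invariant differential rational functions, as a subset of
`C⟨W_e; d⟩`: the fibres over `d` of the invariant differential rational functions on `W`. -/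
def AlgebraicAction.invariants (T : AlgebraicAction d n l) : Set (FunctionField T.We) :=
  {x | ∃ f : DiffRat (constants d) m (Fin l),
    T.IsRational f ∧ T.IsInvariant f ∧ f.toField T.We = x}

variable {T : AlgebraicAction d n l}

/-- The matrix `P₀^d⟨x⟩` over `C⟨W_e; d⟩`. -/
def EquivariantMap.genericP₀ (P : EquivariantMap T) :
    Matrix (Fin n) (Fin n) (FunctionField T.We) :=
  fun i j => (P.P₀ i j).toField T.We

/-- The matrix `P₁^d⟨x⟩` over `C⟨W_e; d⟩`. -/
def EquivariantMap.genericP₁ (P : EquivariantMap T) :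
    Matrix (Fin m) (Fin m) (FunctionField T.We) :=
  fun i j => (P.P₁ i j).toField T.We

/-- The set of components of `P^d⟨x⟩ = (P₀^d⟨x⟩, P₁^d⟨x⟩)`. -/
def EquivariantMap.components (P : EquivariantMap T) : Set (FunctionField T.We) :=
  {x | ∃ i j, x = P.genericP₀ i j} ∪ {x | ∃ i j, x = P.genericP₁ i j}

/-- The operators `P₁^d⟨x⟩⁻¹ d` on `C⟨W_e; d⟩`. -/
def EquivariantMap.delta (P : EquivariantMap T) (hd : Commuting d) :
    Fin m → Derivation ℤ (FunctionField T.We) (FunctionField T.We) :=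
  twist P.genericP₁ (fieldDer hd T.We)

end Action

/-- The smallest subfield of `K` that contains `S` and is stable under the operators `δ`. -/
def diffAdjoin {K : Type*} [Field K] {m : ℕ} (δ : Fin m → Derivation ℤ K K) (S : Set K) :
    Subfield K :=
  sInf {L | S ⊆ L ∧ ∀ i, ∀ a ∈ L, δ i a ∈ L}

end DiffInv

end

noncomputable section

namespace DiffInv

/-!
Moving a point `v` by its own frame `P^δ⟨v⟩` gives the normal form `w = τ^δ⟨P^δ⟨v⟩; v⟩`, which by
equivariance does not change along the orbit of `v`; its components are differential rational
functions with constant coefficients, hence invariants. Moving back by the inverse frame recovers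
`v = τ^(P₁⁻¹δ)⟨P^δ⟨v⟩⁻¹; w⟩`, so every coordinate is a differential rational function, for the
derivations `P₁⁻¹δ`, of the entries of `P` and of invariants. These identities hold pointwise on the
dense set `W₀`; they pass to `C⟨W_e; ∂⟩` because an element of this field is determined by its
values on a dense set on which it is defined.
-/

/-! ### Twisted derivations -/

section MatrixDerivation

variable {R A : Type*} [CommRing R] [CommRing A] [Algebra R A] (D : Derivation R A A)
  {ι κ ρ : Type*} [Fintype κ]

theorem map_derivation_mul (M : Matrix ι κ A) (N : Matrix κ ρ A) :
    (M * N).map D = M.map D * N + M * N.map D := by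
  ext i k
  simp only [Matrix.map_apply, Matrix.mul_apply, Matrix.add_apply, map_sum, Derivation.leibniz,
    smul_eq_mul, ← Finset.sum_add_distrib]
  exact Finset.sum_congr rfl fun j _ => by ring

theorem map_derivation_inv [DecidableEq κ] {M : Matrix κ κ A} (hM : IsUnit M.det) :
    M⁻¹.map D = -(M⁻¹ * M.map D * M⁻¹) := by
  have hone : (1 : Matrix κ κ A).map D = 0 := by
    ext i j
    rw [Matrix.map_apply, Matrix.one_apply]
    split_ifs <;> simp only [Derivation.map_one_eq_zero, map_zero, Matrix.zero_apply]
  have hsum : M.map D * M⁻¹ + M * M⁻¹.map D = 0 := by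
    rw [← map_derivation_mul, Matrix.mul_nonsing_inv _ hM, hone]
  rw [Matrix.mul_assoc, ← Matrix.mul_neg, ← eq_neg_of_add_eq_zero_right hsum,
    Matrix.nonsing_inv_mul_cancel_left _ _ hM]

end MatrixDerivation

section Twist

variable {F : Type*} [Field F] {m : ℕ} {d δ : Fin m → Derivation ℤ F F}
  {g g₁ : Matrix (Fin m) (Fin m) F}

theorem twist_apply (g : Matrix (Fin m) (Fin m) F) (d : Fin m → Derivation ℤ F F) (i : Fin m)
    (a : F) : twist g d i a = ∑ j, g⁻¹ i j * d j a := by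
  have h := congrFun (map_sum Derivation.coeFnAddMonoidHom (fun j => g⁻¹ i j • d j) Finset.univ) a
  rw [Finset.sum_apply] at h
  exact h

theorem apply_eq_sum_twist (hg : IsUnit g.det) (i : Fin m) (a : F) :
    d i a = ∑ j, g i j * twist g d j a := by
  have h : g.mulVec (g⁻¹.mulVec fun j => d j a) = fun j => d j a := by
    rw [Matrix.mulVec_mulVec, Matrix.mul_nonsing_inv _ hg, Matrix.one_mulVec]
  simpa only [Matrix.mulVec, dotProduct, ← twist_apply] using (congrFun h i).symm

theorem twist_twist (g g₁ : Matrix (Fin m) (Fin m) F) :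
    twist g₁ (twist g d) = twist (g * g₁) d := by
  funext i
  ext a
  simp only [twist_apply, Matrix.mul_inv_rev, Matrix.mul_apply, Finset.mul_sum, Finset.sum_mul]
  rw [Finset.sum_comm]
  simp only [mul_assoc]

theorem MemGL.inv (hg : MemGL d g) : MemGL (twist g d) g⁻¹ := by
  refine ⟨Matrix.isUnit_nonsing_inv_det g hg.1, fun i j k => ?_⟩
  have expand (i j : Fin m) : twist g d i (g⁻¹ j k) =
      -∑ s, ∑ a, ∑ b, g⁻¹ i s * (g⁻¹ j a * (d s (g a b) * g⁻¹ b k)) := by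
    have hentry (s : Fin m) : d s (g⁻¹ j k) = -(g⁻¹ * (g.map (d s) * g⁻¹)) j k := by
      rw [← Matrix.mul_assoc]
      exact congrFun (congrFun (map_derivation_inv (d s) hg.1) j) k
    simp only [twist_apply, hentry, Matrix.mul_apply, Matrix.map_apply, mul_neg,
      Finset.sum_neg_distrib, Finset.mul_sum]
  rw [expand i j, expand j i, Finset.sum_comm]
  simp only [hg.2, mul_left_comm (g⁻¹ i _)]

theorem MemGL.mul (hg : MemGL d g) (hg₁ : MemGL (twist g d) g₁) : MemGL d (g * g₁) := by
  refine ⟨by rw [Matrix.det_mul]; exact hg.1.mul hg₁.1, fun i j k => ?_⟩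
  have expand (i j : Fin m) : d i ((g * g₁) j k) = ∑ l, d i (g j l) * g₁ l k +
      ∑ l, ∑ s, g j l * (g i s * twist g d s (g₁ l k)) := by
    have h := congrFun (congrFun (map_derivation_mul (d i) g g₁) j) k
    simp only [Matrix.map_apply, Matrix.mul_apply, Matrix.add_apply] at h
    simp only [Matrix.mul_apply, h, ← Finset.mul_sum, ← apply_eq_sum_twist hg.1]
  rw [expand i j, expand j i, Finset.sum_comm (γ := Fin m) (f := fun l s => g j l * _)]
  simp only [hg.2 i j]
  congr 1
  refine Finset.sum_congr rfl fun s _ => Finset.sum_congr rfl fun l _ => ?_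
  rw [hg₁.2 s l k, mul_left_comm]

/-- Expanding `δ i (δ j a)` for `δ = g⁻¹ d`, the first-order terms are symmetric in `i` and `j`
because `g⁻¹ ∈ GL^δ`. -/
theorem commuting_twist (hd : Commuting d) (hg : MemGL d g) : Commuting (twist g d) := by
  intro i j a
  have expand (i j : Fin m) : twist g d i (twist g d j a) =
      ∑ k, twist g d i (g⁻¹ j k) * d k a + ∑ k, ∑ s, g⁻¹ j k * (g⁻¹ i s * d s (d k a)) := by
    rw [twist_apply g d j, map_sum, ← Finset.sum_add_distrib]
    refine Finset.sum_congr rfl fun k _ => ?_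
    rw [Derivation.leibniz, smul_eq_mul, smul_eq_mul, twist_apply g d i (d k a), Finset.mul_sum,
      add_comm, mul_comm (d k a)]
  rw [expand i j, expand j i, Finset.sum_comm (γ := Fin m) (f := fun k s => g⁻¹ j k * _)]
  simp only [hg.inv.2 i j]
  congr 1
  refine Finset.sum_congr rfl fun s _ => Finset.sum_congr rfl fun k _ => ?_
  rw [hd s k a, mul_left_comm]

theorem twist_mem_base (hδ : δ ∈ base d) (hg : MemGL δ g) : twist g δ ∈ base d := by
  obtain ⟨g₀, hg₀, rfl⟩ := hδ
  exact ⟨g₀ * g, hg₀.mul hg, twist_twist _ _⟩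

theorem Commuting.of_mem_base (hd : Commuting d) (hδ : δ ∈ base d) : Commuting δ := by
  obtain ⟨g₀, hg₀, rfl⟩ := hδ
  exact commuting_twist hd hg₀

theorem apply_constant (hδ : δ ∈ base d) (i : Fin m) (c : constants d) : δ i (c : F) = 0 := by
  obtain ⟨g₀, -, rfl⟩ := hδ
  rw [twist_apply]
  exact Finset.sum_eq_zero fun j _ => by rw [c.2 j, mul_zero]

end Twist

/-! ### Rings of fractions -/

section Fractions

variable {A B : Type*} [CommRing A] [CommRing B] {θ : B →+* A}

/-- The subring of `A` formed by the fractions `θ p / θ q` with `θ q` invertible in `A`. -/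
def fracSubring (θ : B →+* A) : Subring A :=
  (IsLocalization.lift (M := (IsUnit.submonoid A).comap θ)
    (S := Localization ((IsUnit.submonoid A).comap θ)) fun q => q.2).range

theorem mem_fracSubring {a : A} :
    a ∈ fracSubring θ ↔ ∃ p q, IsUnit (θ q) ∧ θ q * a = θ p := by
  constructor
  · rintro ⟨z, rfl⟩
    obtain ⟨p, q, rfl⟩ := IsLocalization.exists_mk'_eq ((IsUnit.submonoid A).comap θ) z
    exact ⟨p, q, q.2, ((IsLocalization.lift_mk'_spec _ _ _ _).1 rfl).symm⟩
  · rintro ⟨p, q, hq, h⟩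
    exact ⟨IsLocalization.mk' _ p ⟨q, hq⟩, (IsLocalization.lift_mk'_spec _ _ _ _).2 h.symm⟩

theorem map_mem_fracSubring (b : B) : θ b ∈ fracSubring θ :=
  mem_fracSubring.2 ⟨b, 1, by simp, by simp⟩

theorem mem_fracSubring_of_mul_eq_one {a b : A} (ha : a ∈ fracSubring θ) (hab : a * b = 1) :
    b ∈ fracSubring θ := by
  obtain ⟨p, q, hq, h⟩ := mem_fracSubring.1 ha
  refine mem_fracSubring.2 ⟨q, p, h ▸ hq.mul (IsUnit.of_mul_eq_one b hab), ?_⟩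
  rw [← h, mul_assoc, hab, mul_one]

theorem derivation_mem_fracSubring (Δ : Derivation ℤ A A) (hΔ : ∀ b, ∃ b', θ b' = Δ (θ b)) {a : A}
    (ha : a ∈ fracSubring θ) : Δ a ∈ fracSubring θ := by
  obtain ⟨p, q, hq, h⟩ := mem_fracSubring.1 ha
  obtain ⟨p', hp'⟩ := hΔ p
  obtain ⟨q', hq'⟩ := hΔ q
  refine mem_fracSubring.2 ⟨q * p' - p * q', q * q, by rw [map_mul]; exact hq.mul hq, ?_⟩
  simp only [map_sub, map_mul, hp', hq', ← h, Derivation.leibniz, smul_eq_mul]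
  ring

/-- The derivation of a product of rings that acts on each factor by a given derivation. -/
def piDerivation {X : Type*} {A : X → Type*} [∀ x, CommRing (A x)]
    (D : ∀ x, Derivation ℤ (A x) (A x)) : Derivation ℤ (∀ x, A x) (∀ x, A x) :=
  Derivation.mk' (LinearMap.pi fun x => (D x : A x →ₗ[ℤ] A x) ∘ₗ LinearMap.proj x)
    fun a b => by
      funext x
      simp

/-- The derivation of a product of two rings that acts on each factor by a given derivation. -/
def prodDerivation (D : Derivation ℤ A A) (E : Derivation ℤ B B) :
    Derivation ℤ (A × B) (A × B) :=
  Derivation.mk' ((D : A →ₗ[ℤ] A).prodMap (E : B →ₗ[ℤ] B)) fun a b => by ext <;> simp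

end Fractions

theorem isUnit_pi_iff_ne_zero {X F : Type*} [Field F] {φ : X → F} : IsUnit φ ↔ ∀ x, φ x ≠ 0 := by
  simp only [Pi.isUnit_iff, isUnit_iff_ne_zero]

/-! ### Rings of functions stable under differentiation -/

section Eval

variable {F R ι X : Type*} [Field F] [CommRing R] [Algebra R F] {m : ℕ}
  {δ : Fin m → Derivation ℤ F F} {D : X → Fin m → Derivation ℤ F F} {u : X → ι → F}

theorem diffEval_C (v : ι → F) (c : R) :
    diffEval δ v (MvPolynomial.C c : DiffPoly R m ι) = algebraMap R F c := by
  simp [diffEval]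

theorem diffEval_X (v : ι → F) (x : ι × (Fin m → ℕ)) :
    diffEval δ v (MvPolynomial.X x : DiffPoly R m ι) = iterD δ x.2 (v x.1) := by
  simp [diffEval]

theorem diffEval_X_zero (v : ι → F) (i : ι) :
    diffEval δ v (MvPolynomial.X (i, 0) : DiffPoly R m ι) = v i := by
  simp [diffEval_X, iterD]

theorem exists_diffEval_eq_derivation (hD : ∀ x, Commuting (D x)) (i : Fin m)
    (hR : ∀ c : R, ∃ c' : R, ∀ x, algebraMap R F c' = D x i (algebraMap R F c))
    (u : X → ι → F) (p : DiffPoly R m ι) :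
    ∃ p' : DiffPoly R m ι, ∀ x, diffEval (D x) (u x) p' = D x i (diffEval (D x) (u x) p) := by
  induction p using MvPolynomial.induction_on with
  | C c =>
    obtain ⟨c', hc'⟩ := hR c
    exact ⟨MvPolynomial.C c', fun x => by rw [diffEval_C, diffEval_C, hc']⟩
  | add p q hp hq =>
    obtain ⟨p', hp'⟩ := hp
    obtain ⟨q', hq'⟩ := hq
    exact ⟨p' + q', fun x => by simp only [map_add, hp', hq']⟩
  | mul_X p y hp =>
    obtain ⟨p', hp'⟩ := hp
    refine ⟨p * MvPolynomial.X (y.1, y.2 + Pi.single i 1) + MvPolynomial.X y * p', fun x => ?_⟩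
    simp only [map_add, map_mul, diffEval_X, hp', Derivation.leibniz, smul_eq_mul,
      iterD_add_single (hD x)]

theorem diffEval_eq_zero_of_dense {W W₀ : Set (ι → F)}
    (hW : W ⊆ @closure _ (kolchinTopology δ) W₀) {p : DiffPoly R m ι}
    (hp : ∀ v ∈ W₀, diffEval δ v p = 0) {v : ι → F} (hv : v ∈ W) : diffEval δ v p = 0 := by
  let _ := kolchinTopology (ι := ι) δ
  have hmem (v : ι → F) :
      v ∈ zeroLocus δ {MvPolynomial.map (algebraMap R F) p} ↔ diffEval δ v p = 0 := by
    simp only [zeroLocus, Set.mem_singleton_iff, forall_eq, Set.mem_ofPred_eq, diffEval,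
      MvPolynomial.aeval_map_algebraMap]
  have hclosed : IsClosed (zeroLocus δ {MvPolynomial.map (algebraMap R F) p}) :=
    (isClosed_iff _ _).2 ⟨_, rfl⟩
  exact (hmem v).1 (closure_minimal (fun w hw => (hmem w).2 (hp w hw)) hclosed (hW hv))

/-- A ring `A` of `F`-valued functions on `X` that can serve as a domain of values for differential
rational functions over `R`: it contains the constants from `R`, is stable under the derivations
`D x` acting on values at `x`, and contains the inverses of its nowhere vanishing elements. -/
structure IsDiffRing (R : Type*) [CommRing R] [Algebra R F] (D : X → Fin m → Derivation ℤ F F)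
    (A : Subring (X → F)) : Prop where
  const_mem : ∀ c : R, (fun _ => algebraMap R F c) ∈ A
  derivation_mem : ∀ i, ∀ φ ∈ A, (fun x => D x i (φ x)) ∈ A
  inv_mem : ∀ φ ∈ A, (∀ x, φ x ≠ 0) → (fun x => (φ x)⁻¹) ∈ A

namespace IsDiffRing

variable {A : Subring (X → F)}

theorem restrictScalars {S : Type*} [CommRing S] [Algebra S F] [Algebra R S] [IsScalarTower R S F]
    (hA : IsDiffRing S D A) : IsDiffRing R D A :=
  ⟨fun c => IsScalarTower.algebraMap_apply R S F c ▸ hA.const_mem _, hA.derivation_mem, hA.inv_mem⟩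

theorem iterD_mem (hA : IsDiffRing R D A) (α : Fin m → ℕ) {φ : X → F} (hφ : φ ∈ A) :
    (fun x => iterD (D x) α (φ x)) ∈ A := by
  have hpow (i : Fin m) (k : ℕ) : ∀ φ ∈ A,
      (fun x => (((D x i : F →ₗ[ℤ] F) : Module.End ℤ F) ^ k) (φ x)) ∈ A := by
    induction k with
    | zero => exact fun φ hφ => hφ
    | succ _ ih => exact fun φ hφ => ih _ (hA.derivation_mem i φ hφ)
  have hprod (L : List (Fin m)) : (fun x => (L.map fun i =>
      ((D x i : F →ₗ[ℤ] F) : Module.End ℤ F) ^ α i).prod (φ x)) ∈ A := by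
    induction L with
    | nil => exact hφ
    | cons i L ih =>
      simp only [List.map_cons, List.prod_cons]
      exact hpow i _ _ ih
  exact hprod _

theorem diffEval_mem (hA : IsDiffRing R D A) (hu : ∀ j, (fun x => u x j) ∈ A)
    (p : DiffPoly R m ι) : (fun x => diffEval (D x) (u x) p) ∈ A := by
  induction p using MvPolynomial.induction_on with
  | C c => simpa only [diffEval_C] using hA.const_mem c
  | add p q hp hq =>
    simp only [map_add]
    exact A.add_mem hp hq
  | mul_X p y hp =>
    simp only [map_mul, diffEval_X]
    exact A.mul_mem hp (hA.iterD_mem y.2 (hu y.1))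

theorem eval_mem (hA : IsDiffRing R D A) (hu : ∀ j, (fun x => u x j) ∈ A) {f : DiffRat R m ι}
    (hf : ∀ x, f.DefinedAt (D x) (u x)) : (fun x => f.eval (D x) (u x)) ∈ A := by
  simp only [DiffRat.eval, div_eq_mul_inv]
  exact A.mul_mem (hA.diffEval_mem hu _) (hA.inv_mem _ (hA.diffEval_mem hu _) hf)

theorem matrix_inv_mem {k : Type*} [Fintype k] [DecidableEq k] (hA : IsDiffRing R D A)
    {M : X → Matrix k k F} (hM : ∀ i j, (fun x => M x i j) ∈ A) (hu : ∀ x, IsUnit (M x).det)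
    (i j : k) : (fun x => (M x)⁻¹ i j) ∈ A := by
  let M' : Matrix k k A := fun i j => ⟨fun x => M x i j, hM i j⟩
  let ev (x : X) : A →+* F := (Pi.evalRingHom _ x).comp A.subtype
  have hdet (x : X) : (M'.det : X → F) x = (M x).det := (ev x).map_det M'
  have hadj (x : X) : (M'.adjugate i j : X → F) x = (M x).adjugate i j :=
    congrFun (congrFun ((ev x).map_adjugate M') i) j
  have hinv (x : X) : (M x)⁻¹ i j = ((M x).det)⁻¹ * (M x).adjugate i j := by
    rw [Matrix.inv_def, Matrix.smul_apply, Ring.inverse_eq_inv', smul_eq_mul]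
  simp only [hinv, ← hdet, ← hadj]
  exact A.mul_mem (hA.inv_mem _ M'.det.2 fun x => hdet x ▸ (hu x).ne_zero) (M'.adjugate i j).2

theorem twist (hA : IsDiffRing R D A) {g : X → Matrix (Fin m) (Fin m) F}
    (hg : ∀ i j, (fun x => g x i j) ∈ A) (hu : ∀ x, IsUnit (g x).det) :
    IsDiffRing R (fun x => twist (g x) (D x)) A := by
  refine ⟨hA.const_mem, fun i φ hφ => ?_, hA.inv_mem⟩
  have hsum : (fun x => DiffInv.twist (g x) (D x) i (φ x)) =
      ∑ j, (fun x => (g x)⁻¹ i j) * fun x => D x j (φ x) := by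
    funext x
    simp [twist_apply]
  rw [hsum]
  exact A.sum_mem fun j _ => A.mul_mem (hA.matrix_inv_mem hg hu i j) (hA.derivation_mem j φ hφ)

theorem act_mem {n l : ℕ} (hA : IsDiffRing R D A) {h : X → Matrix (Fin n) (Fin n) F}
    {g : X → Matrix (Fin m) (Fin m) F} {v : X → Fin l → F} (hh : ∀ i j, (fun x => h x i j) ∈ A)
    (hg : ∀ i j, (fun x => g x i j) ∈ A) (hv : ∀ i, (fun x => v x i) ∈ A)
    {τ : Fin l → DiffRat R m (TripleIndex n m l)} (i : Fin l)
    (hτ : ∀ x, (τ i).DefinedAt (D x) (triple (h x) (g x) (v x))) :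
    (fun x => act τ (D x) (h x) (g x) (v x) i) ∈ A := by
  refine hA.eval_mem (fun a => ?_) hτ
  rcases a with a | a | a
  exacts [hh _ _, hg _ _, hv _]

end IsDiffRing

/-- The evaluation `p ↦ (x ↦ p^(D x){u x})` of differential polynomials along a family of
derivations `D` and points `u`, both of which may vary with `x`. -/
def evalHom (R : Type*) [CommRing R] [Algebra R F] (D : X → Fin m → Derivation ℤ F F)
    (u : X → ι → F) : DiffPoly R m ι →+* (X → F) :=
  RingHom.pi fun x => (diffEval (D x) (u x) : DiffPoly R m ι →ₐ[R] F).toRingHom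

/-- The ring of functions `x ↦ f^(D x)⟨u x⟩`, for the differential rational functions `f` over `R`
that are defined at every `u x`. -/
def regularFunctions (R : Type*) [CommRing R] [Algebra R F] (D : X → Fin m → Derivation ℤ F F)
    (u : X → ι → F) : Subring (X → F) :=
  fracSubring (evalHom R D u)

theorem mem_regularFunctions {φ : X → F} : φ ∈ regularFunctions R D u ↔
    ∃ f : DiffRat R m ι, ∀ x, f.DefinedAt (D x) (u x) ∧ f.eval (D x) (u x) = φ x := by
  constructor
  · intro hφ
    obtain ⟨p, q, hq, h⟩ := mem_fracSubring.1 hφ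
    have hq := isUnit_pi_iff_ne_zero.1 hq
    exact ⟨⟨p, q⟩, fun x => ⟨hq x, (div_eq_iff (hq x)).2
      ((congrFun h x).symm.trans (mul_comm _ _))⟩⟩
  · rintro ⟨f, hf⟩
    exact mem_fracSubring.2 ⟨f.num, f.den, isUnit_pi_iff_ne_zero.2 fun x => (hf x).1,
      funext fun x => (congrArg _ (hf x).2.symm).trans (mul_div_cancel₀ _ (hf x).1)⟩

theorem coord_mem_regularFunctions (i : ι) : (fun x => u x i) ∈ regularFunctions R D u := by
  have h : evalHom R D u (MvPolynomial.X (i, 0)) = fun x => u x i :=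
    funext fun x => diffEval_X_zero (u x) i
  exact h ▸ map_mem_fracSubring (MvPolynomial.X (i, 0))

theorem isDiffRing_regularFunctions (hD : ∀ x, Commuting (D x))
    (hR : ∀ i, ∀ c : R, ∃ c' : R, ∀ x, algebraMap R F c' = D x i (algebraMap R F c)) :
    IsDiffRing R D (regularFunctions R D u) where
  const_mem c := by
    have h : evalHom R D u (MvPolynomial.C c) = fun _ => algebraMap R F c :=
      funext fun x => diffEval_C (u x) c
    exact h ▸ map_mem_fracSubring (MvPolynomial.C c)
  derivation_mem i φ hφ := by
    refine derivation_mem_fracSubring (piDerivation fun x => D x i) (fun p => ?_) hφ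
    obtain ⟨p', hp'⟩ := exists_diffEval_eq_derivation hD i (hR i) u p
    exact ⟨p', funext hp'⟩
  inv_mem φ hφ hne :=
    mem_fracSubring_of_mul_eq_one hφ (funext fun x => mul_inv_cancel₀ (hne x))

theorem isDiffRing_regularFunctions_field (hδ : Commuting δ) (W : Set (ι → F)) :
    IsDiffRing F (fun _ : W => δ) (regularFunctions F (fun _ : W => δ) Subtype.val) :=
  isDiffRing_regularFunctions (fun _ => hδ) fun i c => ⟨δ i c, fun _ => rfl⟩

theorem eq_zero_of_mem_regularFunctions {W W₀ : Set (ι → F)} (hW₀ : W₀ ⊆ W)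
    (hW : W ⊆ @closure _ (kolchinTopology δ) W₀) {φ : W → F}
    (hφ : φ ∈ regularFunctions R (fun _ : W => δ) Subtype.val) (h : ∀ v : W, v.1 ∈ W₀ → φ v = 0) :
    φ = 0 := by
  obtain ⟨f, hf⟩ := mem_regularFunctions.1 hφ
  have hnum (v : ι → F) (hv : v ∈ W₀) : diffEval δ v f.num = 0 := by
    have hfv := hf ⟨v, hW₀ hv⟩
    rw [h _ hv] at hfv
    exact (div_eq_zero_iff.1 hfv.2).resolve_right hfv.1
  funext v
  rw [← (hf v).2, DiffRat.eval, diffEval_eq_zero_of_dense hW hnum v.2, zero_div, Pi.zero_apply]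

end Eval

/-! ### Normal forms and invariants -/

section NormalForm

variable {F : Type*} [Field F] {m n l : ℕ} {d δ : Fin m → Derivation ℤ F F}
  {T : AlgebraicAction d n l} {h : Matrix (Fin n) (Fin n) F} {g : Matrix (Fin m) (Fin m) F}

theorem AlgebraicAction.act_mem_regularFunctions (T : AlgebraicAction d n l) (hd : Commuting d)
    (hδ : δ ∈ base d) (hh : IsUnit h.det) (hg : MemGL δ g) (i : Fin l) :
    (fun v : T.W δ => act T.τ δ h g v i) ∈
      regularFunctions F (fun _ : T.W δ => δ) Subtype.val := by
  have hA := isDiffRing_regularFunctions_field (hd.of_mem_base hδ) (T.W δ)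
  exact (hA.restrictScalars (R := constants d)).act_mem (fun a b => hA.const_mem (h a b))
    (fun a b => hA.const_mem (g a b)) coord_mem_regularFunctions i
    fun v => T.definedAt_τ δ hδ h g hh hg v v.2 i

namespace EquivariantMap

/-- With denominators cleared, invariance is the vanishing on `W δ` of a regular function, which
can be tested on the dense subset `W₀ δ`. -/
theorem isInvariant_of_dense (P : EquivariantMap T) (hd : Commuting d)
    {f : DiffRat (constants d) m (Fin l)} (hf : ∀ δ ∈ base d, ∀ v ∈ P.W₀ δ, f.DefinedAt δ v)
    (hinv : ∀ δ ∈ base d, ∀ (h : Matrix (Fin n) (Fin n) F) (g : Matrix (Fin m) (Fin m) F),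
      IsUnit h.det → MemGL δ g → ∀ v ∈ P.W₀ δ,
        f.eval (twist g δ) (act T.τ δ h g v) = f.eval δ v) : T.IsInvariant f := by
  intro δ hδ h g hh hg v hv hfv hfw
  let A := regularFunctions F (fun _ : T.W δ => δ) Subtype.val
  have hAF : IsDiffRing F (fun _ : T.W δ => δ) A :=
    isDiffRing_regularFunctions_field (hd.of_mem_base hδ) _
  have hA : IsDiffRing (constants d) (fun _ : T.W δ => δ) A := hAF.restrictScalars
  have hAg : IsDiffRing (constants d) (fun _ : T.W δ => twist g δ) A :=
    hA.twist (g := fun _ => g) (fun a b => hAF.const_mem (g a b)) fun _ => hg.1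
  have hsource (p : DiffPoly (constants d) m (Fin l)) :
      (fun v : T.W δ => diffEval δ v p) ∈ A :=
    hA.diffEval_mem coord_mem_regularFunctions p
  have htarget (p : DiffPoly (constants d) m (Fin l)) :
      (fun v : T.W δ => diffEval (twist g δ) (act T.τ δ h g v) p) ∈ A :=
    hAg.diffEval_mem (T.act_mem_regularFunctions hd hδ hh hg) p
  have hcross := eq_zero_of_mem_regularFunctions (P.subset_W δ hδ) (P.dense_W₀ δ hδ)
    (A.sub_mem (A.mul_mem (htarget f.num) (hsource f.den))
      (A.mul_mem (hsource f.num) (htarget f.den)))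
    fun v hv => sub_eq_zero.2 <| (div_eq_div_iff
      (hf _ (twist_mem_base hδ hg) _ (P.act_mem δ hδ h g hh hg v hv)) (hf δ hδ v hv)).1
        (hinv δ hδ h g hh hg v hv)
  exact (div_eq_div_iff hfw hfv).2 (sub_eq_zero.1 (congrFun hcross ⟨v, hv⟩))

/-- The normal form `τ^δ⟨P^δ⟨v⟩; v⟩` of the point `v`: the point of the orbit of `v` at which `P`
takes the value `(1, 1)`. -/
def normalForm (P : EquivariantMap T) (δ : Fin m → Derivation ℤ F F) (v : Fin l → F) : Fin l → F :=
  act T.τ δ (evalMatrix P.P₀ δ v) (evalMatrix P.P₁ δ v) v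

theorem normalForm_act (P : EquivariantMap T) (hδ : δ ∈ base d) (hh : IsUnit h.det)
    (hg : MemGL δ g) {v : Fin l → F} (hv : v ∈ P.W₀ δ) :
    P.normalForm (twist g δ) (act T.τ δ h g v) = P.normalForm δ v := by
  have hδ' := twist_mem_base hδ hg
  have hv' := P.act_mem δ hδ h g hh hg v hv
  rw [normalForm, T.act_act δ hδ h _ g _ hh (P.isUnit_P₀ _ hδ' _ hv') hg
    (P.memGL_P₁ _ hδ' _ hv') v (P.subset_W δ hδ hv), P.equivariant_P₀ δ hδ h g hh hg v hv,
    P.equivariant_P₁ δ hδ h g hh hg v hv, Matrix.mul_nonsing_inv_cancel_left _ _ hh,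
    Matrix.mul_nonsing_inv_cancel_left _ _ hg.1, normalForm]

theorem act_inv_normalForm (P : EquivariantMap T) (hδ : δ ∈ base d) {v : Fin l → F}
    (hv : v ∈ P.W₀ δ) :
    act T.τ (twist (evalMatrix P.P₁ δ v) δ) (evalMatrix P.P₀ δ v)⁻¹ (evalMatrix P.P₁ δ v)⁻¹
      (P.normalForm δ v) = v := by
  have h₀ := P.isUnit_P₀ δ hδ v hv
  have h₁ := P.memGL_P₁ δ hδ v hv
  rw [normalForm, T.act_act δ hδ _ _ _ _ h₀ (Matrix.isUnit_nonsing_inv_det _ h₀) h₁ h₁.inv v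
    (P.subset_W δ hδ hv), Matrix.mul_nonsing_inv _ h₀, Matrix.mul_nonsing_inv _ h₁.1,
    T.act_one δ hδ v (P.subset_W δ hδ hv)]

/-- One function `f` works for all `δ` at once because `regularFunctions` allows the derivations
to vary with the point. -/
theorem exists_normalForm_eq_eval (P : EquivariantMap T) (hd : Commuting d) (i : Fin l) :
    ∃ f : DiffRat (constants d) m (Fin l), ∀ δ ∈ base d, ∀ v ∈ P.W₀ δ,
      f.DefinedAt δ v ∧ f.eval δ v = P.normalForm δ v i := by
  let X := {x : (Fin m → Derivation ℤ F F) × (Fin l → F) // x.1 ∈ base d ∧ x.2 ∈ P.W₀ x.1}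
  have hA : IsDiffRing (constants d) (fun x : X => x.1.1)
      (regularFunctions (constants d) (fun x : X => x.1.1) fun x => x.1.2) :=
    isDiffRing_regularFunctions (fun x => hd.of_mem_base x.2.1)
      fun i c => ⟨0, fun x => (map_zero _).trans (apply_constant x.2.1 i c).symm⟩
  have hP₀ (a b : Fin n) := hA.eval_mem coord_mem_regularFunctions
    fun x => P.definedAt_P₀ _ x.2.1 _ x.2.2 a b
  have hP₁ (a b : Fin m) := hA.eval_mem coord_mem_regularFunctions
    fun x => P.definedAt_P₁ _ x.2.1 _ x.2.2 a b
  obtain ⟨f, hf⟩ := mem_regularFunctions.1 <| hA.act_mem hP₀ hP₁ coord_mem_regularFunctions i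
    fun x => T.definedAt_τ _ x.2.1 _ _ (P.isUnit_P₀ _ x.2.1 _ x.2.2)
      (P.memGL_P₁ _ x.2.1 _ x.2.2) _ (P.subset_W _ x.2.1 x.2.2) i
  exact ⟨f, fun δ hδ v hv => hf ⟨(δ, v), hδ, hv⟩⟩

theorem W₀_nonempty (P : EquivariantMap T) (hδ : δ ∈ base d) : (P.W₀ δ).Nonempty := by
  let _ := kolchinTopology (ι := Fin l) δ
  exact closure_nonempty_iff.1 ((T.isIrreducible_W δ hδ).nonempty.mono (P.dense_W₀ δ hδ))

theorem exists_invariant_eq_normalForm (P : EquivariantMap T) (hd : Commuting d) (i : Fin l) :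
    ∃ f : DiffRat (constants d) m (Fin l), f.toField T.We ∈ T.invariants ∧
      ∀ v ∈ P.W₀ d, f.DefinedAt d v ∧ f.eval d v = P.normalForm d v i := by
  obtain ⟨f, hf⟩ := P.exists_normalForm_eq_eval hd i
  have hrational : T.IsRational f := fun δ hδ =>
    have ⟨v, hv⟩ := P.W₀_nonempty hδ
    ⟨v, P.subset_W δ hδ hv, (hf δ hδ v hv).1⟩
  have hinvariant : T.IsInvariant f := by
    refine P.isInvariant_of_dense hd (fun δ hδ v hv => (hf δ hδ v hv).1) ?_
    intro δ hδ h g hh hg v hv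
    rw [(hf _ (twist_mem_base hδ hg) _ (P.act_mem δ hδ h g hh hg v hv)).2, (hf δ hδ v hv).2,
      P.normalForm_act hδ hh hg hv]
  exact ⟨f, ⟨f, hrational, hinvariant, rfl⟩, hf d (mem_base_self d)⟩

end EquivariantMap

theorem AlgebraicAction.toField_C_mem_invariants (T : AlgebraicAction d n l) (c : constants d) :
    toField T.We (MvPolynomial.C c) ∈ T.invariants := by
  refine ⟨⟨MvPolynomial.C c, 1⟩, fun δ hδ => ?_, fun δ _ h g _ _ v _ _ _ => ?_, ?_⟩
  · obtain ⟨v, hv⟩ := @IsIrreducible.nonempty _ (kolchinTopology δ) _ (T.isIrreducible_W δ hδ)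
    exact ⟨v, hv, by simp [DiffRat.DefinedAt]⟩
  · simp only [DiffRat.eval, diffEval_C, map_one]
  · simp [DiffRat.toField]

end NormalForm

/-! ### The function field and its values on a dense set -/

section FunctionField

variable {F ι : Type*} [Field F] {m : ℕ} {d : Fin m → Derivation ℤ F F}
  {V : IrreducibleClosed d ι} {S : Set (ι → F)}

theorem exists_toField_div (x : FunctionField V) :
    ∃ p q, x = toField V p / toField V q := by
  obtain ⟨a, b, -, rfl⟩ := IsFractionRing.div_surjective
    (A := DiffPoly (constants d) m ι ⧸ vanishingIdeal V) x
  obtain ⟨p, rfl⟩ := Ideal.Quotient.mk_surjective a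
  obtain ⟨q, rfl⟩ := Ideal.Quotient.mk_surjective b
  exact ⟨p, q, rfl⟩

theorem polyDer_comm {R : Type*} [CommRing R] (i j : Fin m) (p : DiffPoly R m ι) :
    polyDer R m ι i (polyDer R m ι j p) = polyDer R m ι j (polyDer R m ι i p) := by
  have h : ⁅polyDer R m ι i, polyDer R m ι j⁆ = 0 := by
    refine MvPolynomial.derivation_ext fun x => ?_
    simp only [Derivation.commutator_apply, polyDer, MvPolynomial.mkDerivation_X,
      Derivation.zero_apply]
    rw [add_right_comm, sub_self]
  rw [← sub_eq_zero, ← Derivation.commutator_apply, h, Derivation.zero_apply]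

theorem commuting_fieldDer (hd : Commuting d) (V : IrreducibleClosed d ι) :
    Commuting (fieldDer hd V) := by
  intro i j x
  have hpoly (p) : ⁅fieldDer hd V i, fieldDer hd V j⁆ (toField V p) = 0 := by
    simp only [Derivation.commutator_apply, fieldDer_toField]
    rw [polyDer_comm, sub_self]
  obtain ⟨p, q, rfl⟩ := exists_toField_div x
  rw [← sub_eq_zero, ← Derivation.commutator_apply, Derivation.leibniz_div, hpoly, hpoly]
  simp

theorem toField_ne_zero (hSV : S ⊆ V.carrier) (hS : S.Nonempty)
    {q : DiffPoly (constants d) m ι} (hq : ∀ v ∈ S, diffEval d v q ≠ 0) : toField V q ≠ 0 := by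
  obtain ⟨v, hv⟩ := hS
  exact fun h => hq v hv (toField_eq_zero.1 h v (hSV hv))

/-- The pairs `(k, φ)` of an element `k` of `C⟨V; d⟩` and its function of values `φ` on `S`, for
the elements `k` that have a representation as a fraction defined on all of `S`. -/
def valueGraph (V : IrreducibleClosed d ι) (S : Set (ι → F)) :
    Subring (FunctionField V × (S → F)) :=
  fracSubring ((toField V).prod (evalHom (constants d) (fun _ : S => d) Subtype.val))

theorem mem_valueGraph {k : FunctionField V} {φ : S → F} : (k, φ) ∈ valueGraph V S ↔
    ∃ f : DiffRat (constants d) m ι, toField V f.den ≠ 0 ∧ f.toField V = k ∧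
      ∀ v : S, f.DefinedAt d v ∧ f.eval d v = φ v := by
  constructor
  · intro hk
    obtain ⟨p, q, hq, h⟩ := mem_fracSubring.1 hk
    obtain ⟨hqV, hqS⟩ := Prod.isUnit_iff.1 hq
    have hqS := isUnit_pi_iff_ne_zero.1 hqS
    obtain ⟨hV, hS⟩ := Prod.ext_iff.1 h
    exact ⟨⟨p, q⟩, hqV.ne_zero, (div_eq_iff hqV.ne_zero).2 (hV.symm.trans (mul_comm _ _)),
      fun v => ⟨hqS v, (div_eq_iff (hqS v)).2 ((congrFun hS v).symm.trans (mul_comm _ _))⟩⟩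
  · rintro ⟨f, hden, rfl, hf⟩
    exact mem_fracSubring.2 ⟨f.num, f.den,
      Prod.isUnit_iff.2 ⟨hden.isUnit, isUnit_pi_iff_ne_zero.2 fun v => (hf v).1⟩,
      Prod.ext (mul_div_cancel₀ _ hden)
        (funext fun v => (congrArg _ (hf v).2.symm).trans (mul_div_cancel₀ _ (hf v).1))⟩

theorem toField_mem_valueGraph (p : DiffPoly (constants d) m ι) :
    (toField V p, fun v : S => diffEval d v p) ∈ valueGraph V S :=
  map_mem_fracSubring p

theorem diffRat_mem_valueGraph (hSV : S ⊆ V.carrier) (hS : S.Nonempty)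
    {f : DiffRat (constants d) m ι} (hf : ∀ v ∈ S, f.DefinedAt d v) :
    (f.toField V, fun v : S => f.eval d v) ∈ valueGraph V S :=
  mem_valueGraph.2 ⟨f, toField_ne_zero hSV hS hf, rfl, fun v => ⟨hf v v.2, rfl⟩⟩

theorem fieldDer_mem_valueGraph (hd : Commuting d) (i : Fin m) {k : FunctionField V} {φ : S → F}
    (h : (k, φ) ∈ valueGraph V S) :
    (fieldDer hd V i k, fun v => d i (φ v)) ∈ valueGraph V S :=
  derivation_mem_fracSubring (prodDerivation (fieldDer hd V i) (piDerivation fun _ : S => d i))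
    (fun p => ⟨polyDer _ m _ i p, Prod.ext (fieldDer_toField hd V i p).symm
      (funext fun v => diffEval_polyDer hd i v.1 p)⟩) h

theorem ne_zero_of_mem_valueGraph (hSV : S ⊆ V.carrier) (hS : S.Nonempty) {k : FunctionField V}
    {φ : S → F} (h : (k, φ) ∈ valueGraph V S) (hφ : ∀ v, φ v ≠ 0) : k ≠ 0 := by
  obtain ⟨f, hden, rfl, hf⟩ := mem_valueGraph.1 h
  refine div_ne_zero (toField_ne_zero hSV hS fun v hv hnum => hφ ⟨v, hv⟩ ?_) hden
  rw [← (hf ⟨v, hv⟩).2, DiffRat.eval, hnum, zero_div]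

theorem inv_mem_valueGraph (hSV : S ⊆ V.carrier) (hS : S.Nonempty) {k : FunctionField V}
    {φ : S → F} (h : (k, φ) ∈ valueGraph V S) (hφ : ∀ v, φ v ≠ 0) :
    (k⁻¹, fun v => (φ v)⁻¹) ∈ valueGraph V S :=
  mem_fracSubring_of_mul_eq_one h (Prod.ext
    (mul_inv_cancel₀ (ne_zero_of_mem_valueGraph hSV hS h hφ))
    (funext fun v => mul_inv_cancel₀ (hφ v)))

theorem eq_of_mem_valueGraph (hVS : V.carrier ⊆ @closure _ (kolchinTopology d) S)
    {k k' : FunctionField V} {φ : S → F} (h : (k, φ) ∈ valueGraph V S)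
    (h' : (k', φ) ∈ valueGraph V S) : k = k' := by
  obtain ⟨f, -, hfk, hf⟩ := mem_valueGraph.1 (sub_mem h h')
  have hnum (v : ι → F) (hv : v ∈ S) : diffEval d v f.num = 0 :=
    (div_eq_zero_iff.1 ((hf ⟨v, hv⟩).2.trans (sub_self _))).resolve_right (hf ⟨v, hv⟩).1
  have hnum' : toField V f.num = 0 :=
    toField_eq_zero.2 fun v hv => diffEval_eq_zero_of_dense hVS hnum hv
  refine sub_eq_zero.1 (hfk.symm.trans ?_)
  rw [DiffRat.toField, hnum', zero_div]

theorem isUnit_det_of_mem_valueGraph (hSV : S ⊆ V.carrier) (hS : S.Nonempty) {κ : Type*}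
    [Fintype κ] [DecidableEq κ] {N : Matrix κ κ (FunctionField V)} {M : S → Matrix κ κ F}
    (h : ∀ i j, (N i j, fun v => M v i j) ∈ valueGraph V S) (hM : ∀ v, IsUnit (M v).det) :
    IsUnit N.det := by
  let A : Matrix κ κ (valueGraph V S) := fun i j => ⟨_, h i j⟩
  let π := (RingHom.fst (FunctionField V) (S → F)).comp (valueGraph V S).subtype
  let ev (v : S) := (Pi.evalRingHom (fun _ : S => F) v).comp
    ((RingHom.snd (FunctionField V) (S → F)).comp (valueGraph V S).subtype)
  have hdet : A.det.1.1 = N.det := π.map_det A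
  have hval (v : S) : A.det.1.2 v = (M v).det := (ev v).map_det A
  rw [← hdet]
  exact (ne_zero_of_mem_valueGraph hSV hS A.det.2 fun v => hval v ▸ (hM v).ne_zero).isUnit

/-- The ring of the functions on `S` that are the values of an element of the subfield `L` of
`C⟨V; d⟩`. -/
def valuesIn (S : Set (ι → F)) (L : Subfield (FunctionField V)) : Subring (S → F) :=
  (valueGraph V S ⊓ L.toSubring.comap (RingHom.fst _ _)).map (RingHom.snd _ _)

theorem mem_valuesIn {L : Subfield (FunctionField V)} {φ : S → F} :
    φ ∈ valuesIn S L ↔ ∃ k ∈ L, (k, φ) ∈ valueGraph V S := by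
  constructor
  · rintro ⟨⟨k, φ⟩, ⟨h, hk⟩, rfl⟩
    exact ⟨k, hk, h⟩
  · rintro ⟨k, hk, h⟩
    exact ⟨(k, φ), ⟨h, hk⟩, rfl⟩

theorem isDiffRing_valuesIn (hd : Commuting d) (hSV : S ⊆ V.carrier) (hS : S.Nonempty)
    {L : Subfield (FunctionField V)} (hC : ∀ c, toField V (MvPolynomial.C c) ∈ L)
    (hD : ∀ i, ∀ a ∈ L, fieldDer hd V i a ∈ L) :
    IsDiffRing (constants d) (fun _ : S => d) (valuesIn S L) where
  const_mem c := mem_valuesIn.2 ⟨_, hC c, by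
    simpa only [diffEval_C] using toField_mem_valueGraph (S := S) (MvPolynomial.C c)⟩
  derivation_mem i φ hφ :=
    have ⟨k, hk, h⟩ := mem_valuesIn.1 hφ
    mem_valuesIn.2 ⟨_, hD i k hk, fieldDer_mem_valueGraph hd i h⟩
  inv_mem φ hφ hne :=
    have ⟨_, hk, h⟩ := mem_valuesIn.1 hφ
    mem_valuesIn.2 ⟨_, L.inv_mem hk, inv_mem_valueGraph hSV hS h hne⟩

theorem toField_mem_of_mem_valuesIn (hVS : V.carrier ⊆ @closure _ (kolchinTopology d) S)
    {L : Subfield (FunctionField V)} {p : DiffPoly (constants d) m ι}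
    (hp : (fun v : S => diffEval d v p) ∈ valuesIn S L) : toField V p ∈ L := by
  obtain ⟨k, hk, h⟩ := mem_valuesIn.1 hp
  rwa [eq_of_mem_valueGraph hVS (toField_mem_valueGraph p) h]

end FunctionField

section GenericFrame

variable {F : Type*} [Field F] {m n l : ℕ} {d : Fin m → Derivation ℤ F F}
  {T : AlgebraicAction d n l}

namespace EquivariantMap

theorem genericP₀_mem_valueGraph (P : EquivariantMap T) (i j : Fin n) :
    (P.genericP₀ i j, fun v : P.W₀ d => evalMatrix P.P₀ d v i j) ∈ valueGraph T.We (P.W₀ d) :=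
  diffRat_mem_valueGraph (P.subset_W d (mem_base_self d)) (P.W₀_nonempty (mem_base_self d))
    fun v hv => P.definedAt_P₀ d (mem_base_self d) v hv i j

theorem genericP₁_mem_valueGraph (P : EquivariantMap T) (i j : Fin m) :
    (P.genericP₁ i j, fun v : P.W₀ d => evalMatrix P.P₁ d v i j) ∈ valueGraph T.We (P.W₀ d) :=
  diffRat_mem_valueGraph (P.subset_W d (mem_base_self d)) (P.W₀_nonempty (mem_base_self d))
    fun v hv => P.definedAt_P₁ d (mem_base_self d) v hv i j

theorem isUnit_det_genericP₀ (P : EquivariantMap T) : IsUnit P.genericP₀.det :=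
  isUnit_det_of_mem_valueGraph (P.subset_W d (mem_base_self d)) (P.W₀_nonempty (mem_base_self d))
    P.genericP₀_mem_valueGraph fun v => P.isUnit_P₀ d (mem_base_self d) v v.2

theorem memGL_genericP₁ (P : EquivariantMap T) (hd : Commuting d) :
    MemGL (fieldDer hd T.We) P.genericP₁ := by
  have hGL (v : P.W₀ d) : MemGL d (evalMatrix P.P₁ d v) := P.memGL_P₁ d (mem_base_self d) v v.2
  refine ⟨isUnit_det_of_mem_valueGraph (P.subset_W d (mem_base_self d))
    (P.W₀_nonempty (mem_base_self d)) P.genericP₁_mem_valueGraph fun v => (hGL v).1,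
    fun i j k => ?_⟩
  have hder (i j : Fin m) := fieldDer_mem_valueGraph hd i (P.genericP₁_mem_valueGraph j k)
  have hsymm := hder i j
  simp only [(hGL _).2 i j k] at hsymm
  exact eq_of_mem_valueGraph (P.dense_W₀ d (mem_base_self d)) hsymm (hder j i)

theorem commuting_delta (P : EquivariantMap T) (hd : Commuting d) : Commuting (P.delta hd) :=
  commuting_twist (commuting_fieldDer hd T.We) (P.memGL_genericP₁ hd)

end EquivariantMap

end GenericFrame

/-! ### Generation of the function field -/

section Generation

variable {m : ℕ}

theorem subset_diffAdjoin {K : Type*} [Field K] (δ : Fin m → Derivation ℤ K K) (S : Set K) :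
    S ⊆ diffAdjoin δ S :=
  fun _ hx => Subfield.mem_sInf.2 fun _ hL => hL.1 hx

theorem derivation_mem_diffAdjoin {K : Type*} [Field K] {δ : Fin m → Derivation ℤ K K} {S : Set K}
    (i : Fin m) {a : K} (ha : a ∈ diffAdjoin δ S) : δ i a ∈ diffAdjoin δ S :=
  Subfield.mem_sInf.2 fun L hL => hL.2 i a (Subfield.mem_sInf.1 ha L hL)

theorem derivation_mem_of_twist_mem {K : Type*} [Field K] {d : Fin m → Derivation ℤ K K}
    {g : Matrix (Fin m) (Fin m) K} (hg : IsUnit g.det) {L : Subfield K} (hL : ∀ i j, g i j ∈ L)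
    (hδ : ∀ i, ∀ a ∈ L, twist g d i a ∈ L) (i : Fin m) {a : K} (ha : a ∈ L) : d i a ∈ L := by
  rw [apply_eq_sum_twist hg]
  exact L.sum_mem fun j _ => L.mul_mem (hL i j) (hδ j a ha)

theorem multiIndex_induction {p : (Fin m → ℕ) → Prop} (zero : p 0)
    (add_single : ∀ α i, p α → p (α + Pi.single i 1)) (α : Fin m → ℕ) : p α := by
  induction α using WellFoundedLT.induction with
  | ind α ih =>
    rcases eq_or_ne α 0 with rfl | hα
    · exact zero
    obtain ⟨i, hi⟩ := Function.ne_iff.1 hα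
    have hle : Pi.single i 1 ≤ α := by
      intro j
      rcases eq_or_ne j i with rfl | hj
      · simpa using Nat.one_le_iff_ne_zero.2 hi
      · simp [hj]
    have hlt : α - Pi.single i 1 < α := by
      refine lt_of_le_of_ne tsub_le_self fun h => ?_
      have := congrFun h i
      simp only [Pi.sub_apply, Pi.single_eq_same, Pi.zero_apply] at this hi
      omega
    have h := add_single _ i (ih _ hlt)
    rwa [tsub_add_cancel_of_le hle] at h

variable {F : Type*} [Field F] {d : Fin m → Derivation ℤ F F}

theorem eq_top_of_coords_mem {ι : Type*} {V : IrreducibleClosed d ι} (hd : Commuting d)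
    {L : Subfield (FunctionField V)} (hC : ∀ c, toField V (MvPolynomial.C c) ∈ L)
    (hX : ∀ i, toField V (MvPolynomial.X (i, 0)) ∈ L)
    (hD : ∀ i, ∀ a ∈ L, fieldDer hd V i a ∈ L) : L = ⊤ := by
  have hvar (i : ι) (α : Fin m → ℕ) : toField V (MvPolynomial.X (i, α)) ∈ L := by
    induction α using multiIndex_induction with
    | zero => exact hX i
    | add_single α j hα =>
      simpa only [fieldDer_toField, polyDer, MvPolynomial.mkDerivation_X] using hD j _ hα
  have hpoly (p : DiffPoly (constants d) m ι) : toField V p ∈ L := by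
    induction p using MvPolynomial.induction_on with
    | C c => exact hC c
    | add p q hp hq => exact map_add (toField V) p q ▸ L.add_mem hp hq
    | mul_X p x hp => exact map_mul (toField V) p _ ▸ L.mul_mem hp (hvar x.1 x.2)
  refine eq_top_iff.2 fun x _ => ?_
  obtain ⟨p, q, rfl⟩ := exists_toField_div x
  exact L.div_mem (hpoly p) (hpoly q)

namespace EquivariantMap

variable {n l : ℕ} {T : AlgebraicAction d n l}

theorem toField_coord_mem (P : EquivariantMap T) (hd : Commuting d)
    {L : Subfield (FunctionField T.We)} (hinv : T.invariants ⊆ L) (hP : P.components ⊆ L)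
    (hD : ∀ i, ∀ a ∈ L, fieldDer hd T.We i a ∈ L) (i : Fin l) :
    toField T.We (MvPolynomial.X (i, 0)) ∈ L := by
  have hd₀ := mem_base_self d
  have hW₀ := P.subset_W d hd₀
  have hne := P.W₀_nonempty hd₀
  have hu₀ (v : P.W₀ d) := P.isUnit_P₀ d hd₀ v v.2
  have hGL (v : P.W₀ d) := P.memGL_P₁ d hd₀ v v.2
  have hA : IsDiffRing (constants d) (fun _ : P.W₀ d => d) (valuesIn (P.W₀ d) L) :=
    isDiffRing_valuesIn hd hW₀ hne (fun c => hinv (T.toField_C_mem_invariants c)) hD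
  have hP₀ (a b) : (fun v : P.W₀ d => evalMatrix P.P₀ d v a b) ∈ valuesIn (P.W₀ d) L :=
    mem_valuesIn.2 ⟨_, hP (Or.inl ⟨a, b, rfl⟩), P.genericP₀_mem_valueGraph a b⟩
  have hP₁ (a b) : (fun v : P.W₀ d => evalMatrix P.P₁ d v a b) ∈ valuesIn (P.W₀ d) L :=
    mem_valuesIn.2 ⟨_, hP (Or.inr ⟨a, b, rfl⟩), P.genericP₁_mem_valueGraph a b⟩
  have hnormal (a) : (fun v : P.W₀ d => P.normalForm d v a) ∈ valuesIn (P.W₀ d) L := by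
    obtain ⟨f, hf, heval⟩ := P.exists_invariant_eq_normalForm hd a
    refine mem_valuesIn.2 ⟨_, hinv hf, ?_⟩
    simpa only [fun v : P.W₀ d => (heval v v.2).2] using
      diffRat_mem_valueGraph hW₀ hne fun v hv => (heval v hv).1
  have hcoord := (hA.twist hP₁ fun v => (hGL v).1).act_mem (hA.matrix_inv_mem hP₀ hu₀)
    (hA.matrix_inv_mem hP₁ fun v => (hGL v).1) hnormal i fun v =>
      T.definedAt_τ _ (twist_mem_base hd₀ (hGL v)) _ _ (Matrix.isUnit_nonsing_inv_det _ (hu₀ v))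
        (hGL v).inv _ (T.act_mem d hd₀ _ _ (hu₀ v) (hGL v) v (hW₀ v.2)) i
  refine toField_mem_of_mem_valuesIn (P.dense_W₀ d hd₀) ?_
  simpa only [diffEval_X_zero, fun v : P.W₀ d => P.act_inv_normalForm hd₀ v.2] using hcoord

theorem diffAdjoin_eq_top (P : EquivariantMap T) (hd : Commuting d) :
    diffAdjoin (P.delta hd) (T.invariants ∪ P.components) = ⊤ := by
  have hsub := subset_diffAdjoin (P.delta hd) (T.invariants ∪ P.components)
  have hinv := Set.subset_union_left.trans hsub
  have hP := Set.subset_union_right.trans hsub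
  have hD (i) : ∀ a ∈ diffAdjoin (P.delta hd) (T.invariants ∪ P.components),
      fieldDer hd T.We i a ∈ diffAdjoin (P.delta hd) (T.invariants ∪ P.components) :=
    fun a ha => derivation_mem_of_twist_mem (P.memGL_genericP₁ hd).1
      (fun i j => hP (Or.inr ⟨i, j, rfl⟩)) (fun i _ => derivation_mem_diffAdjoin i) i ha
  exact eq_top_of_coords_mem hd (fun c => hinv (T.toField_C_mem_invariants c))
    (P.toField_coord_mem hd hinv hP hD) hD

end EquivariantMap

end Generation

end DiffInv

end

theorem corollary2p5_general {F : Type*} [Field F] {m n l : ℕ} (d : Fin m → Derivation ℤ F F)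
    (hcomm : DiffInv.Commuting d) (T : DiffInv.AlgebraicAction d n l)
    (P : DiffInv.EquivariantMap T) :
    IsUnit P.genericP₀.det ∧ IsUnit P.genericP₁.det ∧ DiffInv.Commuting (P.delta hcomm) ∧
      DiffInv.diffAdjoin (P.delta hcomm) (T.invariants ∪ P.components) = ⊤ :=
  ⟨P.isUnit_det_genericP₀, (P.memGL_genericP₁ hcomm).1, P.commuting_delta hcomm,
    P.diffAdjoin_eq_top hcomm⟩

theorem corollary2p5 {F : Type*} [Field F] [CharZero F] {m n l : ℕ}
    (d : Fin m → Derivation ℤ F F) (hcomm : DiffInv.Commuting d)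
    (hindep : LinearIndependent F d) (hclosed : DiffInv.IsDifferentiallyClosed d)
    (T : DiffInv.AlgebraicAction d n l) (P : DiffInv.EquivariantMap T) :
    IsUnit P.genericP₀.det ∧ IsUnit P.genericP₁.det ∧ DiffInv.Commuting (P.delta hcomm) ∧
      DiffInv.diffAdjoin (P.delta hcomm) (T.invariants ∪ P.components) = ⊤ :=
  corollary2p5_general d hcomm T P
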